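/- Let $\mathbb K$ be a field, $n\ge 0$, $V=\mathbb K^n$, and let $\mathcal A=\mathcal A_G=\{\{x_i=x_j\}\mid ij\in E(G)\}$ be the graphical arrangement in $V$ of a simple graph $G$ on the vertex set $\{1,\dots,n\}$. Let $L(\mathcal A)$ be its intersection lattice, that is, the set of all intersections of hyperplanes of $\mathcal A$ (including the empty intersection $V$) ordered by reverse inclusion, with rank function $r(X)=n-\dim X$, join $X\vee Y=X\cap Y$, meet $X\wedge Y=\bigcap\{Z\in L(\mathcal A)\mid X\cup Y\subseteq Z\}$ and maximal element $T=\bigcap_{H\in\mathcal A}H$, and let $r=r(T)$ be the rank of $\mathcal A$. For $X\in L(\mathcal A)$ put $\mathcal A_X=\{H\in\mathcal A\mid X\subseteq H\}$. A set partition $\pi$ of $\mathcal A$ (into nonempty, pairwise disjoint parts with union $\mathcal A$) is called nice if 1. for every $p\ge 0$ and all hyperplanes $H_1,\dots,H_p\in\mathcal A$ lying in pairwise different parts of $\pi$, $r(H_1\cap\dots\cap H_p)=p$; and 2. for every $X\in L(\mathcal A)\setminus\{V\}$ there is a part $P$ of $\pi$ with $|P\cap\mathcal A_X|=1$. An element $X\in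 L(\mathcal A)$ is called modular if $r(X)+r(Y)=r(X\vee Y)+r(X\wedge Y)$ for all $Y\in L(\mathcal A)$, and a maximal modular chain is a maximal chain of $L(\mathcal A)$ all of whose elements are modular. **Theorem.** For every nice partition $\pi$ of $\mathcal A$ there is a maximal modular chain $V=X_0<X_1<\dots<X_r=T$ of $L(\mathcal A)$ such that $\pi=\{\pi_1,\dots,\pi_r\}$ with $\pi_i=\mathcal A_{X_i}\setminus\mathcal A_{X_{i-1}}$ for $1\le i\le r$. In other words, every nice partition of a graphical arrangement is induced by a maximal modular chain of its intersection lattice. -/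

import Mathlib

/-- A central hyperplane arrangement in `V = K ^ n`: a finite set of linear hyperplanes, that is,
of linear subspaces of dimension `n - 1`. -/
structure HypArr (K : Type*) [Field K] (n : ℕ) where
  /-- the set of hyperplanes -/
  carrier : Set (Submodule K (Fin n → K))
  finite : carrier.Finite
  finrank_add_one : ∀ H ∈ carrier, Module.finrank K H + 1 = n

/-- The hyperplane `H_{ij} : x_i - x_j = 0` in `K ^ n` (a hyperplane when `i ≠ j`). -/
def diagHyperplane (K : Type*) [Field K] {n : ℕ} (i j : Fin n) : Submodule K (Fin n → K) :=
  LinearMap.ker (LinearMap.proj (R := K) (φ := fun _ : Fin n => K) i - LinearMap.proj j)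

theorem mem_diagHyperplane {K : Type*} [Field K] {n : ℕ} {i j : Fin n} {x : Fin n → K} :
    x ∈ diagHyperplane K i j ↔ x i = x j := by
  simp [diagHyperplane, sub_eq_zero]

theorem finrank_diagHyperplane {K : Type*} [Field K] {n : ℕ} {i j : Fin n} (h : i ≠ j) :
    Module.finrank K (diagHyperplane K i j) + 1 = n := by
  have hne : (LinearMap.proj (R := K) (φ := fun _ : Fin n => K) i - LinearMap.proj j) ≠ 0 := by
    intro h0
    have h1 := LinearMap.congr_fun h0 (Pi.single i 1)
    simp [h.symm] at h1
  have h2 := Module.Dual.finrank_ker_add_one_of_ne_zero (K := K) hne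
  rw [Module.finrank_fin_fun] at h2
  exact h2

/-- The graphical arrangement `A_G = {H_{ij} | ij ∈ E(G)}` in `K ^ n` of a simple graph `G` on `n`
vertices. -/
def graphicalArr (K : Type*) [Field K] {n : ℕ} (G : SimpleGraph (Fin n)) : HypArr K n where
  carrier := {H | ∃ i j, G.Adj i j ∧ H = diagHyperplane K i j}
  finite := by
    refine (Set.finite_range (fun p : Fin n × Fin n => diagHyperplane K p.1 p.2)).subset ?_
    rintro H ⟨i, j, -, rfl⟩
    exact ⟨(i, j), rfl⟩
  finrank_add_one := by
    rintro H ⟨i, j, hij, rfl⟩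
    exact finrank_diagHyperplane hij.ne

namespace HypArr

/-- The intersection lattice `L(A)`: all intersections of hyperplanes of `A`; the empty
intersection is `V = ⊤`. It is ordered by reverse inclusion, so `X < Y` in `L(A)` means that
`Y` is strictly contained in `X` as a subspace. -/
def lattice {K : Type*} [Field K] {n : ℕ} (A : HypArr K n) : Set (Submodule K (Fin n → K)) :=
  {X | ∃ B ⊆ A.carrier, X = sInf B}

/-- The maximal element `T` of `L(A)`, the intersection of all hyperplanes of `A`. -/
def center {K : Type*} [Field K] {n : ℕ} (A : HypArr K n) : Submodule K (Fin n → K) :=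
  sInf A.carrier

/-- The rank function `r(X) = n - dim X`. The subtraction never truncates, as `dim X ≤ n`. -/
noncomputable def rk {K : Type*} [Field K] {n : ℕ} (X : Submodule K (Fin n → K)) : ℕ :=
  n - Module.finrank K X

/-- The rank of the arrangement, `r(T)`. -/
noncomputable def rank {K : Type*} [Field K] {n : ℕ} (A : HypArr K n) : ℕ := rk A.center

/-- The localization `A_X`, the set of hyperplanes of `A` that contain `X`. -/
def localization {K : Type*} [Field K] {n : ℕ} (A : HypArr K n) (X : Submodule K (Fin n → K)) :
    Set (Submodule K (Fin n → K)) :=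
  {H ∈ A.carrier | X ≤ H}

/-- The join in `L(A)`, namely `X ∨ Y = X ∩ Y`. -/
def latJoin {K : Type*} [Field K] {n : ℕ} (X Y : Submodule K (Fin n → K)) :
    Submodule K (Fin n → K) := X ⊓ Y

/-- The meet in `L(A)`, the intersection of all `Z ∈ L(A)` that contain both `X` and `Y`. -/
def latMeet {K : Type*} [Field K] {n : ℕ} (A : HypArr K n) (X Y : Submodule K (Fin n → K)) :
    Submodule K (Fin n → K) := sInf {Z ∈ A.lattice | X ≤ Z ∧ Y ≤ Z}

/-- `X` is a modular element of `L(A)`: `X ∈ L(A)` and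
`r(X) + r(Y) = r(X ∨ Y) + r(X ∧ Y)` for all `Y ∈ L(A)`. -/
def IsModular {K : Type*} [Field K] {n : ℕ} (A : HypArr K n) (X : Submodule K (Fin n → K)) :
    Prop :=
  X ∈ A.lattice ∧ ∀ Y ∈ A.lattice, rk X + rk Y = rk (latJoin X Y) + rk (A.latMeet X Y)

/-- `V = X_0 < X_1 < ⋯ < X_r = T` is a maximal chain of `L(A)` (order: reverse inclusion) that
consists of modular elements. -/
structure IsMaxModularChain {K : Type*} [Field K] {n : ℕ} (A : HypArr K n) {r : ℕ}
    (X : Fin (r + 1) → Submodule K (Fin n → K)) : Prop where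
  zero : X 0 = ⊤
  last : X (Fin.last r) = A.center
  strictAnti : StrictAnti X
  modular : ∀ i, A.IsModular (X i)
  maximal : ∀ Y ∈ A.lattice, (∀ i, Y ≤ X i ∨ X i ≤ Y) → ∃ i, Y = X i

/-- `π` is an (unordered) set partition of `A`: its parts are nonempty, pairwise disjoint, and
their union is `A`. -/
structure IsPartition {K : Type*} [Field K] {n : ℕ} (A : HypArr K n)
    (π : Set (Set (Submodule K (Fin n → K)))) : Prop where
  nonempty : ∀ P ∈ π, P.Nonempty
  disjoint : ∀ P ∈ π, ∀ Q ∈ π, P ≠ Q → Disjoint P Q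
  union : ⋃₀ π = A.carrier

/-- `S = (S_1, …, S_p)` is a `p`-section of `π`: a tuple of hyperplanes of `A` whose entries lie in
pairwise different parts of `π`. -/
def IsSection {K : Type*} [Field K] {n : ℕ} (A : HypArr K n)
    (π : Set (Set (Submodule K (Fin n → K)))) {p : ℕ} (S : Fin p → Submodule K (Fin n → K)) :
    Prop :=
  (∀ k, S k ∈ A.carrier) ∧ ∀ k l, k ≠ l → ∀ P ∈ π, S k ∈ P → S l ∉ P

/-- A tuple `(S_1, …, S_p)` is independent when `r(S_1 ∩ ⋯ ∩ S_p) = p`. -/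
def IsIndependentTuple {K : Type*} [Field K] {n : ℕ} {p : ℕ}
    (S : Fin p → Submodule K (Fin n → K)) : Prop :=
  rk (⨅ k, S k) = p

/-- `π` is a nice partition of `A`: all sections of `π` are independent, and for every
`X ∈ L(A)` with `X ≠ V` some part of `π` meets `A_X` in exactly one hyperplane. -/
structure IsNice {K : Type*} [Field K] {n : ℕ} (A : HypArr K n)
    (π : Set (Set (Submodule K (Fin n → K)))) : Prop where
  partition : A.IsPartition π
  independent : ∀ (p : ℕ) (S : Fin p → Submodule K (Fin n → K)),
    A.IsSection π S → IsIndependentTuple S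
  singleton : ∀ X ∈ A.lattice, X ≠ ⊤ → ∃ P ∈ π, (P ∩ A.localization X).ncard = 1

end HypArr

/-!
Why every nice partition of a graphical arrangement comes from a maximal modular chain.

Hyperplanes of the arrangement are edges of `G`, and a nice partition is a colouring of the edges.
Applied to elements of rank two, the singleton condition says that two edges of the same colour
share a vertex and that the third edge of the triangle which they span exists and has another colour
(`IsNice.common_vertex`, `IsNice.triangle`). In particular a part with at least two edges is a star
(`IsNice.star`). The independence condition says that the edges of a closed walk never have pairwise
different colours (`IsNice.not_isSection_closed_walk`). Only these consequences are used.

The key is to find a part `P` none of whose hyperplanes contains the intersection `X₀` of the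
hyperplanes outside `P`. It suffices that no triangle meets `P` in exactly one edge
(`IsNice.not_center_deletePart_le`): a closed walk that uses `P` exactly once can be shortened to
such a triangle. If every part `P` did meet some triangle in exactly one edge, then the other two
edges of that triangle would form the tip of a star `g P`, and going round a periodic orbit of `g`
from one centre to the next would give a closed walk with edges of pairwise different colours
(`IsNice.exists_maximal_part`).

For such a part, the centre is a hyperplane in `X₀`, and `X₀` is modular
(`IsNice.isModular_center_deletePart`); here modularity of `X` is used in the form that `X + Y` is in
the lattice for all `Y` in the lattice (`isModular_iff`). Deleting the edges of `P` from `G` leaves a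
nice partition, so by induction on the rank it comes from a chain that ends at `X₀`. Its elements
stay modular, and appending the centre gives the chain for `G` (`IsMaxModularChain.snoc`).
-/

namespace HypArr

variable {K : Type*} [Field K] {n : ℕ} {G : SimpleGraph (Fin n)}
  {π : Set (Set (Submodule K (Fin n → K)))} {P : Set (Submodule K (Fin n → K))}

/-! ### Diagonal hyperplanes -/

theorem diagHyperplane_comm (i j : Fin n) : diagHyperplane K i j = diagHyperplane K j i := by
  ext x
  simp only [mem_diagHyperplane, eq_comm]

theorem diagHyperplane_inf_le (i j k : Fin n) :
    diagHyperplane K i j ⊓ diagHyperplane K j k ≤ diagHyperplane K i k := by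
  intro x hx
  simp only [Submodule.mem_inf, mem_diagHyperplane] at hx ⊢
  exact hx.1.trans hx.2

theorem indicator_mem_diagHyperplane {W : Set (Fin n)} {i j : Fin n} :
    W.indicator (fun _ => (1 : K)) ∈ diagHyperplane K i j ↔ (i ∈ W ↔ j ∈ W) := by
  classical
  rw [mem_diagHyperplane]
  by_cases hi : i ∈ W <;> by_cases hj : j ∈ W <;> simp [hi, hj]

theorem diagHyperplane_eq {a b i j : Fin n} (hij : i ≠ j) (hi : i = a ∨ i = b)
    (hj : j = a ∨ j = b) : diagHyperplane K i j = diagHyperplane K a b := by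
  rcases hi with rfl | rfl <;> rcases hj with rfl | rfl <;>
    first | exact absurd rfl hij | rfl | exact diagHyperplane_comm _ _

theorem eq_or_eq_of_diagHyperplane_le {a b i j : Fin n} (hij : i ≠ j)
    (h : diagHyperplane K a b ≤ diagHyperplane K i j) :
    (i = a ∨ i = b) ∧ (j = a ∨ j = b) := by
  have key (W : Set (Fin n)) (hW : a ∈ W ↔ b ∈ W) : i ∈ W ↔ j ∈ W :=
    indicator_mem_diagHyperplane.1 (h (indicator_mem_diagHyperplane.2 hW))
  have h1 := key {i}
  have h2 := key {j}
  simp only [Set.mem_singleton_iff] at h1 h2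
  grind

theorem diagHyperplane_mem_graphicalArr {i j : Fin n} :
    diagHyperplane K i j ∈ (graphicalArr K G).carrier ↔ G.Adj i j := by
  refine ⟨?_, fun h => ⟨i, j, h, rfl⟩⟩
  rintro ⟨a, b, hab, h⟩
  have := eq_or_eq_of_diagHyperplane_le hab.ne h.le
  rcases this with ⟨rfl | rfl, rfl | rfl⟩
  · exact absurd rfl hab.ne
  · exact hab
  · exact hab.symm
  · exact absurd rfl hab.ne

/-! ### Parts of a nice partition -/

theorem IsNice.subset {A : HypArr K n} (hπ : A.IsNice π) (hP : P ∈ π) : P ⊆ A.carrier :=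
  hπ.partition.union ▸ Set.subset_sUnion_of_mem hP

theorem IsNice.exists_part {A : HypArr K n} (hπ : A.IsNice π) {H : Submodule K (Fin n → K)}
    (hH : H ∈ A.carrier) : ∃ P ∈ π, H ∈ P := by
  rwa [← hπ.partition.union, Set.mem_sUnion] at hH

theorem IsNice.eq_of_mem {A : HypArr K n} (hπ : A.IsNice π) {Q : Set (Submodule K (Fin n → K))}
    {H : Submodule K (Fin n → K)} (hP : P ∈ π) (hQ : Q ∈ π) (h : H ∈ P) (h' : H ∈ Q) : P = Q := by
  by_contra hne
  exact Set.disjoint_left.1 (hπ.partition.disjoint P hP Q hQ hne) h h'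

theorem IsNice.adj (hπ : (graphicalArr K G).IsNice π) (hP : P ∈ π) {i j : Fin n}
    (h : diagHyperplane K i j ∈ P) : G.Adj i j :=
  diagHyperplane_mem_graphicalArr.1 (hπ.subset hP h)

/-- The rank two case of the singleton condition: the localization at the intersection of two
hyperplanes of a part is not contained in that part. -/
theorem IsNice.exists_third {A : HypArr K n} (hπ : A.IsNice π) (hP : P ∈ π)
    {H₁ H₂ : Submodule K (Fin n → K)} (h₁ : H₁ ∈ P) (h₂ : H₂ ∈ P) (hne : H₁ ≠ H₂) :
    ∃ H ∈ A.carrier, H ∉ P ∧ H₁ ⊓ H₂ ≤ H := by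
  have hA := hπ.subset hP
  have htop : H₁ ⊓ H₂ ≠ ⊤ := fun h =>
    hne (by rw [inf_eq_top_iff] at h; rw [h.1, h.2])
  obtain ⟨Q, hQ, hcard⟩ := hπ.singleton (H₁ ⊓ H₂)
    ⟨{H₁, H₂}, by rintro H (rfl | rfl) <;> [exact hA h₁; exact hA h₂], sInf_pair.symm⟩ htop
  obtain ⟨H, hH⟩ := Set.ncard_eq_one.1 hcard
  have hHm : H ∈ Q ∩ A.localization (H₁ ⊓ H₂) := hH ▸ rfl
  refine ⟨H, hHm.2.1, fun hHP => hne ?_, hHm.2.2⟩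
  obtain rfl := hπ.eq_of_mem hP hQ hHP hHm.1
  have m₁ : H₁ ∈ P ∩ A.localization (H₁ ⊓ H₂) := ⟨h₁, hA h₁, inf_le_left⟩
  have m₂ : H₂ ∈ P ∩ A.localization (H₁ ⊓ H₂) := ⟨h₂, hA h₂, inf_le_right⟩
  rw [hH] at m₁ m₂
  exact m₁.trans m₂.symm

/-- Two edges of the same part have a common vertex. -/
theorem IsNice.common_vertex (hπ : (graphicalArr K G).IsNice π) (hP : P ∈ π) {a b c d : Fin n}
    (h₁ : diagHyperplane K a b ∈ P) (h₂ : diagHyperplane K c d ∈ P) :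
    a = c ∨ a = d ∨ b = c ∨ b = d := by
  by_contra! hd
  have hne : diagHyperplane K a b ≠ diagHyperplane K c d := fun h => by
    have := eq_or_eq_of_diagHyperplane_le (hπ.adj hP h₂).ne h.le
    grind
  obtain ⟨_, ⟨i, j, hij, rfl⟩, hn, hle⟩ := hπ.exists_third hP h₁ h₂ hne
  have key (W : Set (Fin n)) (h1 : a ∈ W ↔ b ∈ W) (h2 : c ∈ W ↔ d ∈ W) : i ∈ W ↔ j ∈ W :=
    indicator_mem_diagHyperplane.1
      (hle ⟨indicator_mem_diagHyperplane.2 h1, indicator_mem_diagHyperplane.2 h2⟩)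
  have k1 := key {a, b} (by simp) (by simp; grind)
  have k2 := key {c, d} (by simp; grind) (by simp)
  have k3 := key {i}
  simp only [Set.mem_insert_iff, Set.mem_singleton_iff] at k1 k2 k3
  have e1 := diagHyperplane_eq (K := K) (a := a) (b := b) hij.ne
  have e2 := diagHyperplane_eq (K := K) (a := c) (b := d) hij.ne
  have := hij.ne
  grind

/-- Two adjacent edges of the same part span a triangle, whose third edge lies in another part. -/
theorem IsNice.triangle (hπ : (graphicalArr K G).IsNice π) (hP : P ∈ π) {a b d : Fin n}
    (h₁ : diagHyperplane K a b ∈ P) (h₂ : diagHyperplane K b d ∈ P) (had : a ≠ d) :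
    G.Adj a d ∧ diagHyperplane K a d ∉ P := by
  have hab := (hπ.adj hP h₁).ne
  have hbd := (hπ.adj hP h₂).ne
  have hne : diagHyperplane K a b ≠ diagHyperplane K b d := fun h => by
    have := eq_or_eq_of_diagHyperplane_le hbd h.le
    grind
  obtain ⟨_, ⟨i, j, hij, rfl⟩, hn, hle⟩ := hπ.exists_third hP h₁ h₂ hne
  have key (W : Set (Fin n)) (h1 : a ∈ W ↔ b ∈ W) (h2 : b ∈ W ↔ d ∈ W) : i ∈ W ↔ j ∈ W :=
    indicator_mem_diagHyperplane.1
      (hle ⟨indicator_mem_diagHyperplane.2 h1, indicator_mem_diagHyperplane.2 h2⟩)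
  have k1 := key {a, b, d} (by simp) (by simp)
  have k3 := key {i}
  have k4 := key {j}
  simp only [Set.mem_insert_iff, Set.mem_singleton_iff] at k1 k3 k4
  have e1 := diagHyperplane_eq (K := K) (a := a) (b := b) hij.ne
  have e2 := diagHyperplane_eq (K := K) (a := b) (b := d) hij.ne
  have := hij.ne
  have hcase : (i = a ∧ j = d) ∨ (i = d ∧ j = a) := by grind
  rcases hcase with ⟨rfl, rfl⟩ | ⟨rfl, rfl⟩
  · exact ⟨hij, hn⟩
  · exact ⟨hij.symm, diagHyperplane_comm (K := K) i j ▸ hn⟩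

/-- The edges of a closed walk cannot lie in pairwise different parts: dropping the last edge does
not change the intersection, but it would lower the rank. -/
theorem IsNice.not_isSection_closed_walk {A : HypArr K n} (hπ : A.IsNice π) {k : ℕ}
    (c : ℕ → Fin n) (hc : c (k + 1) = c 0) :
    ¬ A.IsSection π (fun i : Fin (k + 1) => diagHyperplane K (c i) (c (i + 1))) := by
  intro hs
  have hs' : A.IsSection π (fun i : Fin k => diagHyperplane K (c i) (c (i + 1))) :=
    ⟨fun i => hs.1 i.castSucc, fun i j hij =>
      hs.2 i.castSucc j.castSucc (fun h => hij (Fin.castSucc_injective _ h))⟩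
  have r₁ : rk _ = k + 1 := hπ.independent _ _ hs
  have r₂ : rk _ = k := hπ.independent _ _ hs'
  have heq : (⨅ i : Fin (k + 1), diagHyperplane K (c i) (c (i + 1))) =
      ⨅ i : Fin k, diagHyperplane K (c i) (c (i + 1)) := by
    refine le_antisymm (le_iInf fun i => iInf_le _ i.castSucc) (le_iInf fun i => ?_)
    intro x hx
    simp only [Submodule.mem_iInf, mem_diagHyperplane] at hx ⊢
    have hconst : ∀ m ≤ k, x (c m) = x (c 0) := by
      intro m
      induction m with
      | zero => intro _; rfl
      | succ m ih => intro hm; rw [← hx ⟨m, hm⟩]; exact ih (by omega)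
    rw [hconst i (by omega)]
    rcases Nat.lt_or_ge i k with hi | hi
    · rw [hconst _ hi]
    · rw [show (i : ℕ) = k by omega, hc]
  rw [heq, r₂] at r₁
  omega

/-- In a triangle, two edges outside a part that contains the third edge lie in a common part. -/
theorem IsNice.exists_part_of_triangle (hπ : (graphicalArr K G).IsNice π) (hP : P ∈ π)
    {u v w : Fin n} (huv : diagHyperplane K u v ∈ P) (hwu : G.Adj w u) (hwv : G.Adj w v)
    (hu : diagHyperplane K w u ∉ P) (hv : diagHyperplane K w v ∉ P) :
    ∃ Q ∈ π, diagHyperplane K w u ∈ Q ∧ diagHyperplane K w v ∈ Q := by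
  obtain ⟨Q, hQ, hQu⟩ := hπ.exists_part (diagHyperplane_mem_graphicalArr.2 hwu)
  refine ⟨Q, hQ, hQu, ?_⟩
  by_contra hQv
  let c : ℕ → Fin n := fun i => if i = 1 then u else if i = 2 then v else w
  refine hπ.not_isSection_closed_walk (k := 2) c (by simp [c]) ⟨?_, ?_⟩
  · intro i
    rw [diagHyperplane_mem_graphicalArr]
    fin_cases i <;> simp [c, hwu, hwv.symm, hπ.adj hP huv]
  · -- Only the pairs `i < j` need checking.
    have hlt : ∀ i j : Fin 3, i < j → ∀ R ∈ π, diagHyperplane K (c i) (c (i + 1)) ∈ R →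
        diagHyperplane K (c j) (c (j + 1)) ∉ R := by
      intro i j hij R hR h₁ h₂
      fin_cases i <;> fin_cases j <;> simp [c] at hij h₁ h₂
      · exact hu (hπ.eq_of_mem hR hP h₂ huv ▸ h₁)
      · rw [diagHyperplane_comm] at h₂
        exact hQv (hπ.eq_of_mem hR hQ h₁ hQu ▸ h₂)
      · rw [diagHyperplane_comm] at h₂
        exact hv (hπ.eq_of_mem hR hP h₁ huv ▸ h₂)
    intro i j hij R hR h₁ h₂
    rcases lt_or_gt_of_ne hij with h | h
    · exact hlt i j h R hR h₁ h₂
    · exact hlt j i h R hR h₂ h₁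

/-- A part with two edges at `w` is a star with centre `w`. -/
theorem IsNice.star (hπ : (graphicalArr K G).IsNice π) (hP : P ∈ π) {u v w x y : Fin n}
    (huv : u ≠ v) (hu : diagHyperplane K w u ∈ P) (hv : diagHyperplane K w v ∈ P)
    (hxy : diagHyperplane K x y ∈ P) : w = x ∨ w = y := by
  have h₁ := hπ.common_vertex hP hu hxy
  have h₂ := hπ.common_vertex hP hv hxy
  have h₃ := (hπ.triangle hP (diagHyperplane_comm (K := K) w u ▸ hu) hv huv).2
  by_contra! hn
  refine h₃ ?_
  rw [diagHyperplane_eq huv (a := x) (b := y) (by grind) (by grind)]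
  exact hxy

/-- Some part contains, of every triangle that it meets, at least two edges. Otherwise every part
`P` contains exactly one edge of some triangle, whose other two edges lie in a part `g P` with
centre `w P`. As `g P` is a star, the centres along a periodic orbit of `g` form a closed walk whose
edges lie in pairwise different parts. -/
theorem IsNice.exists_maximal_part (hπ : (graphicalArr K G).IsNice π) (hne : π.Nonempty) :
    ∃ P ∈ π, ∀ u v w, diagHyperplane K u v ∈ P → G.Adj w u → G.Adj w v →
      diagHyperplane K w u ∈ P ∨ diagHyperplane K w v ∈ P := by
  by_contra! hcon
  have hstep : ∀ P : π, ∃ (Q : π) (w u v : Fin n), diagHyperplane K u v ∈ P.1 ∧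
      diagHyperplane K w u ∈ Q.1 ∧ diagHyperplane K w v ∈ Q.1 := by
    rintro ⟨P, hP⟩
    obtain ⟨u, v, w, huv, hwu, hwv, hu, hv⟩ := hcon P hP
    obtain ⟨Q, hQ, h₁, h₂⟩ := hπ.exists_part_of_triangle hP huv hwu hwv hu hv
    exact ⟨⟨Q, hQ⟩, w, u, v, huv, h₁, h₂⟩
  choose g w u v huv hwu hwv using hstep
  have hedge (P : π) : diagHyperplane K (w P) (w (g P)) ∈ (g (g P)).1 := by
    rcases hπ.star (g P).2 (hπ.adj P.2 (huv P)).ne (hwu P) (hwv P) (huv (g P)) with h | h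
    · rw [h, diagHyperplane_comm]
      exact hwu (g P)
    · rw [h, diagHyperplane_comm]
      exact hwv (g P)
  have : Finite π := by
    refine ((graphicalArr K G).finite.finite_subsets.subset ?_).to_subtype
    exact fun P hP => hπ.subset hP
  have : Nonempty π := hne.to_subtype
  obtain ⟨P, k, hk, hinj⟩ : ∃ (P : π) (k : ℕ), g^[k + 1] P = P ∧
      ∀ i < k + 1, ∀ j < k + 1, g^[i] (g^[2] P) = g^[j] (g^[2] P) → i = j := by
    obtain ⟨i, j, hij, h⟩ := Finite.exists_ne_map_eq_of_infinite
      (fun i : ℕ => g^[i] (Classical.arbitrary π))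
    wlog hlt : i < j generalizing i j
    · exact this j i hij.symm h.symm (by omega)
    set P := g^[i] (Classical.arbitrary π) with hPdef
    have hper : Function.IsPeriodicPt g (j - i) P := by
      rw [Function.IsPeriodicPt, Function.IsFixedPt, hPdef, ← Function.iterate_add_apply,
        Nat.sub_add_cancel hlt.le]
      exact h.symm
    have hmem : P ∈ Function.periodicPts g := ⟨j - i, by omega, hper⟩
    have hpos := Function.minimalPeriod_pos_of_mem_periodicPts hmem
    have hper2 := Function.minimalPeriod_apply_iterate hmem 2
    refine ⟨P, Function.minimalPeriod g P - 1, ?_, ?_⟩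
    · rw [Nat.sub_add_cancel hpos]
      exact Function.iterate_minimalPeriod
    · rw [Nat.sub_add_cancel hpos, ← hper2]
      intro a ha b hb hab
      exact Function.iterate_injOn_Iio_minimalPeriod ha hb hab
  have hmem (i : ℕ) : diagHyperplane K (w (g^[i] P)) (w (g^[i + 1] P)) ∈ (g^[i] (g^[2] P)).1 := by
    have h := hedge (g^[i] P)
    have h₁ : g (g^[i] P) = g^[i + 1] P := (Function.iterate_succ_apply' g i P).symm
    have h₂ : g (g^[i + 1] P) = g^[i] (g^[2] P) := by
      rw [← Function.iterate_succ_apply' g, ← Function.iterate_add_apply]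
    rwa [h₁, h₂] at h
  refine hπ.not_isSection_closed_walk (k := k) (fun i => w (g^[i] P)) (by simp only [hk]; rfl)
    ⟨fun i => hπ.subset (Subtype.prop _) (hmem i), ?_⟩
  intro i j hij R hR h₁ h₂
  have e₁ := hπ.eq_of_mem (Subtype.prop _) hR (hmem i) h₁
  have e₂ := hπ.eq_of_mem (Subtype.prop _) hR (hmem j) h₂
  exact hij (Fin.ext (hinj i i.2 j j.2 (Subtype.ext (e₁.trans e₂.symm))))

/-! ### Removing a part -/

/-- The graph obtained from `G` by deleting the edges whose hyperplanes belong to `P`. -/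
def deletePart (G : SimpleGraph (Fin n)) (P : Set (Submodule K (Fin n → K))) :
    SimpleGraph (Fin n) where
  Adj i j := G.Adj i j ∧ diagHyperplane K i j ∉ P
  symm := ⟨fun i j h => ⟨h.1.symm, diagHyperplane_comm (K := K) i j ▸ h.2⟩⟩
  loopless := ⟨fun _ h => h.1.ne rfl⟩

theorem carrier_deletePart :
    (graphicalArr K (deletePart G P)).carrier = (graphicalArr K G).carrier \ P := by
  ext H
  constructor
  · rintro ⟨i, j, hij, rfl⟩
    exact ⟨⟨i, j, hij.1, rfl⟩, hij.2⟩
  · rintro ⟨⟨i, j, hij, rfl⟩, hP⟩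
    exact ⟨i, j, ⟨hij, hP⟩, rfl⟩

/-- Hyperplanes containing the centre of a graphical arrangement correspond to pairs of vertices in
the same connected component: the indicator function of a component lies in the centre. -/
theorem reachable_of_center_le {i j : Fin n}
    (h : (graphicalArr K G).center ≤ diagHyperplane K i j) : G.Reachable i j := by
  have hmem : {x | G.Reachable i x}.indicator (fun _ => (1 : K)) ∈ (graphicalArr K G).center := by
    rw [center, Submodule.mem_sInf]
    rintro _ ⟨a, b, hab, rfl⟩
    rw [indicator_mem_diagHyperplane]
    exact ⟨fun ha => ha.trans hab.reachable, fun hb => hb.trans hab.symm.reachable⟩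
  exact (indicator_mem_diagHyperplane.1 (h hmem)).1 (SimpleGraph.Reachable.refl i)

/-- If a part contains, of every triangle that it meets, at least two edges, then none of its
hyperplanes contains the intersection of the remaining hyperplanes. Otherwise an edge of `P` and a
shortest path outside `P` between its endpoints form a closed walk. Choosing the edge so that
the path is as short as possible, two edges of this walk never lie in the same part: they would span
a triangle, and its third edge would give a shorter path. -/
theorem IsNice.not_center_deletePart_le (hπ : (graphicalArr K G).IsNice π) (hP : P ∈ π)
    (hmax : ∀ u v w, diagHyperplane K u v ∈ P → G.Adj w u → G.Adj w v →
      diagHyperplane K w u ∈ P ∨ diagHyperplane K w v ∈ P) {H : Submodule K (Fin n → K)}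
    (hH : H ∈ P) : ¬ (graphicalArr K (deletePart G P)).center ≤ H := by
  intro hle
  obtain ⟨a, b, hab, rfl⟩ := hπ.subset hP hH
  set D := deletePart G P with hD
  have hex : ∃ k x y, diagHyperplane K x y ∈ P ∧ ∃ p : D.Walk x y, p.length = k := by
    obtain ⟨p⟩ := reachable_of_center_le hle
    exact ⟨_, a, b, hH, p, rfl⟩
  classical
  obtain ⟨x, y, hxy, p, hp⟩ := Nat.find_spec hex
  have hmin : ∀ x' y', diagHyperplane K x' y' ∈ P → ∀ q : D.Walk x' y', p.length ≤ q.length :=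
    fun x' y' h q => hp ▸ Nat.find_min' hex ⟨x', y', h, q, rfl⟩
  have hadj := hπ.adj hP hxy
  set k := p.length with hk
  let c : ℕ → Fin n := fun i => if i ≤ k then p.getVert i else x
  have hc {i : ℕ} (hi : i ≤ k) : c i = p.getVert i := if_pos hi
  have c0 : c 0 = x := by rw [hc (Nat.zero_le _), p.getVert_zero]
  have ck : c k = y := by rw [hc le_rfl, p.getVert_length]
  have ck1 : c (k + 1) = x := if_neg (by omega)
  have hDadj {i : ℕ} (hi : i < k) : D.Adj (c i) (c (i + 1)) := by
    rw [hc hi.le, hc hi]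
    exact p.adj_getVert_succ hi
  -- The vertex `c i` has distance `i` from `x` in `D`.
  have hdist {i : ℕ} (hi : i ≤ k) : D.dist x (c i) = i := by
    rw [hc hi]
    apply le_antisymm
    · have := D.dist_le (p.take i)
      rw [SimpleGraph.Walk.take_length] at this
      omega
    · obtain ⟨q, hq⟩ := (p.take i).reachable.exists_walk_length_eq_dist
      have := hmin x y hxy (q.append (p.drop i))
      rw [SimpleGraph.Walk.length_append, SimpleGraph.Walk.drop_length, hq] at this
      omega
  have hinj {i j : ℕ} (hi : i ≤ k) (hj : j ≤ k) (h : c i = c j) : i = j := by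
    rw [← hdist hi, h, hdist hj]
  have hk3 : 3 ≤ k := by
    by_contra! hlt
    interval_cases hkk : k
    · exact hadj.ne (c0.symm.trans ck)
    · have h := hDadj (i := 0) one_pos
      rw [c0, ck] at h
      exact h.2 hxy
    · have h₀ := hDadj (i := 0) two_pos
      have h₁ := hDadj (i := 1) one_lt_two
      rw [c0] at h₀
      rw [ck] at h₁
      rcases hmax x y (c 1) hxy h₀.1.symm h₁.1 with h | h
      · exact h₀.symm.2 h
      · exact h₁.2 h
  have hnot {i j : ℕ} (hij : i < j) (hj : j ≤ k) (R : Set (Submodule K (Fin n → K))) (hR : R ∈ π)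
      (h₁ : diagHyperplane K (c i) (c (i + 1)) ∈ R)
      (h₂ : diagHyperplane K (c j) (c (j + 1)) ∈ R) : False := by
    rcases hj.lt_or_eq with hj | rfl
    · have hcv := hπ.common_vertex hR h₁ h₂
      have hji : j = i + 1 := by
        rcases hcv with h | h | h | h <;> have := hinj (by omega) (by omega) h <;> omega
      subst hji
      have hne : c i ≠ c (i + 1 + 1) := fun h => by
        have := hinj (by omega) (by omega) h
        omega
      have had := (hπ.triangle hR h₁ h₂ hne).1
      by_cases hin : diagHyperplane K (c i) (c (i + 1 + 1)) ∈ P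
      · have := hmin _ _ hin (.cons (hDadj (by omega)) (.cons (hDadj (by omega)) .nil))
        simp only [SimpleGraph.Walk.length_cons, SimpleGraph.Walk.length_nil] at this
        omega
      · have hDa : D.Adj (c i) (c (i + 1 + 1)) := ⟨had, hin⟩
        have hr : D.Reachable x (c i) := by
          rw [hc (by omega)]
          exact (p.take i).reachable
        obtain ⟨q, hq⟩ := hr.exists_walk_length_eq_dist
        have := D.dist_le (q.concat hDa)
        rw [SimpleGraph.Walk.length_concat, hq, hdist (by omega), hdist (by omega)] at this
        omega
    · rw [ck, ck1, diagHyperplane_comm] at h₂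
      exact (hDadj hij).2 (hπ.eq_of_mem hR hP h₂ hxy ▸ h₁)
  refine hπ.not_isSection_closed_walk (k := k) c (ck1.trans c0.symm) ⟨fun i => ?_, ?_⟩
  · rw [diagHyperplane_mem_graphicalArr]
    rcases Nat.lt_or_ge i k with hi | hi
    · exact (hDadj hi).1
    · rw [show (i : ℕ) = k by omega, ck, ck1]
      exact hadj.symm
  · intro i j hij R hR h₁ h₂
    rcases lt_or_gt_of_ne hij with h | h
    · exact hnot h (by omega) R hR h₁ h₂
    · exact hnot h (by omega) R hR h₂ h₁

/-! ### Modular elements -/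

theorem sInf_localization {A : HypArr K n} {X : Submodule K (Fin n → K)} (hX : X ∈ A.lattice) :
    sInf (A.localization X) = X := by
  obtain ⟨B, hB, rfl⟩ := hX
  exact le_antisymm (sInf_le_sInf fun H hH => ⟨hB hH, sInf_le hH⟩) (le_sInf fun H hH => hH.2)

theorem sInf_mem_lattice {A : HypArr K n} {S : Set (Submodule K (Fin n → K))}
    (hS : S ⊆ A.lattice) : sInf S ∈ A.lattice := by
  refine ⟨A.localization (sInf S), fun H hH => hH.1, le_antisymm (le_sInf fun H hH => hH.2) ?_⟩
  refine le_sInf fun Z hZ => ?_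
  rw [← sInf_localization (hS hZ)]
  exact sInf_le_sInf fun H hH => ⟨hH.1, (sInf_le hZ).trans hH.2⟩

theorem center_le {A : HypArr K n} {X : Submodule K (Fin n → K)} (hX : X ∈ A.lattice) :
    A.center ≤ X := by
  obtain ⟨B, hB, rfl⟩ := hX
  exact sInf_le_sInf hB

theorem rk_add_finrank (X : Submodule K (Fin n → K)) : rk X + Module.finrank K X = n := by
  have h : Module.finrank K X ≤ n := by simpa using Submodule.finrank_le X
  exact Nat.sub_add_cancel h

/-- Modularity of `X` says that `X + Y` belongs to the lattice for all `Y`: the meet of `X` and `Y`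
contains `X + Y`, and the rank formula compares their dimensions. -/
theorem isModular_iff {A : HypArr K n} {X : Submodule K (Fin n → K)} :
    A.IsModular X ↔ X ∈ A.lattice ∧ ∀ Y ∈ A.lattice, X ⊔ Y ∈ A.lattice := by
  refine and_congr_right fun _ => forall₂_congr fun Y _ => ?_
  have hle : X ⊔ Y ≤ A.latMeet X Y := le_sInf fun Z hZ => sup_le hZ.2.1 hZ.2.2
  have hdim := Submodule.finrank_sup_add_finrank_inf_eq X Y
  have h₁ := rk_add_finrank X
  have h₂ := rk_add_finrank Y
  have h₃ := rk_add_finrank (X ⊓ Y)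
  constructor
  · intro h
    replace h : rk X + rk Y = rk (X ⊓ Y) + rk (A.latMeet X Y) := h
    have h₄ := rk_add_finrank (A.latMeet X Y)
    rw [Submodule.eq_of_le_of_finrank_eq hle (by omega)]
    exact sInf_mem_lattice fun Z hZ => hZ.1
  · intro h
    have heq : A.latMeet X Y = X ⊔ Y := le_antisymm (sInf_le ⟨h, le_sup_left, le_sup_right⟩) hle
    have h₄ := rk_add_finrank (X ⊔ Y)
    change rk X + rk Y = rk (X ⊓ Y) + rk (A.latMeet X Y)
    rw [heq]
    omega

theorem isModular_center (A : HypArr K n) : A.IsModular A.center := by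
  rw [isModular_iff]
  refine ⟨⟨_, subset_rfl, rfl⟩, fun Y hY => ?_⟩
  rwa [sup_eq_right.2 (center_le hY)]

theorem sup_eq_top_of_not_le {A : HypArr K n} {X H : Submodule K (Fin n → K)}
    (hH : H ∈ A.carrier) (h : ¬ X ≤ H) : X ⊔ H = ⊤ := by
  have h₁ := A.finrank_add_one H hH
  have h₂ : Module.finrank K H < Module.finrank K (X ⊔ H : Submodule K (Fin n → K)) :=
    Submodule.finrank_lt_finrank_of_lt (right_lt_sup.2 h)
  have h₃ : Module.finrank K (X ⊔ H : Submodule K (Fin n → K)) ≤ n := by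
    simpa using Submodule.finrank_le (X ⊔ H)
  exact Submodule.eq_top_of_finrank_eq (by rw [Module.finrank_fin_fun]; omega)

theorem finrank_inf_add_one {A : HypArr K n} {X H : Submodule K (Fin n → K)}
    (hH : H ∈ A.carrier) (h : ¬ X ≤ H) :
    Module.finrank K (X ⊓ H : Submodule K (Fin n → K)) + 1 = Module.finrank K X := by
  have h₁ := A.finrank_add_one H hH
  have h₂ := Submodule.finrank_sup_add_finrank_inf_eq X H
  rw [sup_eq_top_of_not_le hH h, finrank_top, Module.finrank_fin_fun] at h₂
  omega

/-- Modulo the hyperplanes outside `P`, an element of the lattice is cut out by any single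
hyperplane `H` of `P` that contains it: any other such hyperplane `H'` completes a triangle with `H`,
whose third hyperplane lies outside `P`. -/
theorem IsNice.eq_inf_of_mem (hπ : (graphicalArr K G).IsNice π) (hP : P ∈ π)
    {Y H : Submodule K (Fin n → K)} (hY : Y ∈ (graphicalArr K G).lattice) (hH : H ∈ P)
    (hYH : Y ≤ H) : Y = sInf ((graphicalArr K G).localization Y \ P) ⊓ H := by
  refine le_antisymm (le_inf (le_sInf fun H' h => h.1.2) hYH) ?_
  conv_rhs => rw [← sInf_localization hY]
  refine le_sInf fun H' hH' => ?_
  by_cases hHP : H' ∈ P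
  swap
  · exact inf_le_left.trans (sInf_le ⟨hH', hHP⟩)
  obtain ⟨a, b, hab, rfl⟩ := hπ.subset hP hH
  obtain ⟨c, d, hcd, rfl⟩ := hH'.1
  have key (a b d : Fin n) (h₁ : diagHyperplane K a b ∈ P) (h₂ : diagHyperplane K b d ∈ P)
      (hY₁ : Y ≤ diagHyperplane K a b) (hY₂ : Y ≤ diagHyperplane K b d) :
      sInf ((graphicalArr K G).localization Y \ P) ⊓ diagHyperplane K a b ≤
        diagHyperplane K b d := by
    by_cases had : a = d
    · rw [had, diagHyperplane_comm]
      exact inf_le_right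
    · obtain ⟨hadj, hn⟩ := hπ.triangle hP h₁ h₂ had
      have hle : sInf ((graphicalArr K G).localization Y \ P) ≤ diagHyperplane K a d :=
        sInf_le ⟨⟨⟨a, d, hadj, rfl⟩,
          (le_inf hY₁ hY₂).trans (diagHyperplane_inf_le a b d)⟩, hn⟩
      refine (le_inf inf_le_right (inf_le_left.trans hle)).trans ?_
      rw [diagHyperplane_comm a b]
      exact diagHyperplane_inf_le b a d
  rcases hπ.common_vertex hP hH hHP with rfl | rfl | rfl | rfl
  · have := key b a d
    simp only [diagHyperplane_comm (K := K) b a] at this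
    exact this hH hHP hYH hH'.2
  · have := key b a c
    simp only [diagHyperplane_comm (K := K) b a, diagHyperplane_comm (K := K) a c] at this
    exact this hH hHP hYH hH'.2
  · exact key a b d hH hHP hYH hH'.2
  · have := key a b c
    simp only [diagHyperplane_comm (K := K) b c] at this
    exact this hH hHP hYH hH'.2

theorem lattice_deletePart_subset :
    (graphicalArr K (deletePart G P)).lattice ⊆ (graphicalArr K G).lattice := by
  rintro X ⟨B, hB, rfl⟩
  refine ⟨B, hB.trans ?_, rfl⟩
  rw [carrier_deletePart]
  exact Set.sdiff_subset

/-- When no hyperplane of `P` contains the intersection of the others, the localization at an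
element containing that intersection is not affected by the deletion of `P`. -/
theorem localization_deletePart
    (hX₀ : ∀ H ∈ P, ¬ (graphicalArr K (deletePart G P)).center ≤ H)
    {X : Submodule K (Fin n → K)} (hX : (graphicalArr K (deletePart G P)).center ≤ X) :
    (graphicalArr K (deletePart G P)).localization X = (graphicalArr K G).localization X := by
  ext H
  rw [localization, carrier_deletePart]
  exact ⟨fun h => ⟨h.1.1, h.2⟩, fun h => ⟨⟨h.1, fun hP => hX₀ H hP (hX.trans h.2)⟩, h.2⟩⟩

theorem mem_lattice_deletePart
    (hX₀ : ∀ H ∈ P, ¬ (graphicalArr K (deletePart G P)).center ≤ H)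
    {X : Submodule K (Fin n → K)} (hX : (graphicalArr K (deletePart G P)).center ≤ X)
    (hXL : X ∈ (graphicalArr K G).lattice) :
    X ∈ (graphicalArr K (deletePart G P)).lattice :=
  ⟨(graphicalArr K (deletePart G P)).localization X, fun _ h => h.1, by
    rw [localization_deletePart hX₀ hX, sInf_localization hXL]⟩

/-- The intersection of the hyperplanes outside a suitable part `P` is modular. For an element `Y`
contained in some hyperplane `H` of `P`, write `Y = Z ∩ H` with `Z` an intersection of hyperplanes
outside `P`; the modular law for subspaces gives `X + Y = Z` for this intersection `X`. -/
theorem IsNice.isModular_center_deletePart (hπ : (graphicalArr K G).IsNice π) (hP : P ∈ π)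
    (hX₀ : ∀ H ∈ P, ¬ (graphicalArr K (deletePart G P)).center ≤ H) :
    (graphicalArr K G).IsModular (graphicalArr K (deletePart G P)).center := by
  rw [isModular_iff]
  refine ⟨lattice_deletePart_subset ⟨_, subset_rfl, rfl⟩, fun Y hY => ?_⟩
  by_cases h : ∃ H ∈ P, Y ≤ H
  · obtain ⟨H, hH, hYH⟩ := h
    set Z := sInf ((graphicalArr K G).localization Y \ P) with hZ
    have hXZ : (graphicalArr K (deletePart G P)).center ≤ Z := by
      refine sInf_le_sInf fun H' hH' => ?_
      rw [carrier_deletePart]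
      exact ⟨hH'.1.1, hH'.2⟩
    rw [hπ.eq_inf_of_mem hP hY hH hYH, ← hZ, inf_comm, ← sup_inf_assoc_of_le _ hXZ,
      sup_eq_top_of_not_le (hπ.subset hP hH) (hX₀ H hH), top_inf_eq]
    exact ⟨_, fun H' hH' => hH'.1.1, rfl⟩
  · -- No hyperplane of `P` contains `Y`, so `Y` contains the intersection of the others.
    push Not at h
    have hle : (graphicalArr K (deletePart G P)).center ≤ Y := by
      rw [← sInf_localization hY]
      refine sInf_le_sInf fun H hH => ?_
      rw [carrier_deletePart]
      exact ⟨hH.1, fun hHP => h H hHP hH.2⟩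
    rwa [sup_eq_right.2 hle]

/-- An element that is modular below the modular element `X₀ = ⋂ (𝒜 ∖ P)` is modular: for any `Y`,
`X + Y = X + (X₀ + Y)`, as `X` contains `X₀`. -/
theorem isModular_of_deletePart
    (hX₀ : ∀ H ∈ P, ¬ (graphicalArr K (deletePart G P)).center ≤ H)
    (hmod : (graphicalArr K G).IsModular (graphicalArr K (deletePart G P)).center)
    {X : Submodule K (Fin n → K)} (hX : (graphicalArr K (deletePart G P)).IsModular X) :
    (graphicalArr K G).IsModular X := by
  rw [isModular_iff] at hX hmod ⊢
  refine ⟨lattice_deletePart_subset hX.1, fun Y hY => lattice_deletePart_subset (P := P) ?_⟩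
  have h := hX.2 _ (mem_lattice_deletePart hX₀ le_sup_left (hmod.2 Y hY))
  rwa [← sup_assoc, sup_eq_left.2 (center_le hX.1)] at h

/-- The remaining parts form a nice partition: the lattice only loses elements, and the
localizations at those that remain do not meet `P`. -/
theorem IsNice.deletePart (hπ : (graphicalArr K G).IsNice π) (hP : P ∈ π)
    (hX₀ : ∀ H ∈ P, ¬ (graphicalArr K (deletePart G P)).center ≤ H) :
    (graphicalArr K (deletePart G P)).IsNice (π \ {P}) where
  partition :=
    { nonempty := fun Q hQ => hπ.partition.nonempty Q hQ.1
      disjoint := fun Q hQ R hR => hπ.partition.disjoint Q hQ.1 R hR.1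
      union := by
        rw [carrier_deletePart]
        ext H
        constructor
        · rintro ⟨Q, hQ, hH⟩
          exact ⟨hπ.subset hQ.1 hH, fun hHP => hQ.2 (hπ.eq_of_mem hQ.1 hP hH hHP)⟩
        · rintro ⟨hH, hHP⟩
          obtain ⟨Q, hQ, hHQ⟩ := hπ.exists_part hH
          exact ⟨Q, ⟨hQ, fun h => hHP (h ▸ hHQ)⟩, hHQ⟩ }
  independent := by
    intro p S hS
    have hmem (k : Fin p) : S k ∈ (graphicalArr K G).carrier \ P := by
      rw [← carrier_deletePart]
      exact hS.1 k
    refine hπ.independent p S ⟨fun k => (hmem k).1, fun k l hkl Q hQ hk => ?_⟩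
    exact hS.2 k l hkl Q ⟨hQ, fun h => (hmem k).2 (h ▸ hk)⟩ hk
  singleton := by
    intro X hX htop
    obtain ⟨Q, hQ, hcard⟩ := hπ.singleton X (lattice_deletePart_subset hX) htop
    have hloc := localization_deletePart hX₀ (center_le hX)
    refine ⟨Q, ⟨hQ, ?_⟩, by rwa [hloc]⟩
    rintro rfl
    obtain ⟨H, hH⟩ := Set.ncard_eq_one.1 hcard
    have hm : H ∈ Q ∩ (graphicalArr K G).localization X := hH ▸ rfl
    exact hX₀ H hm.1 ((center_le hX).trans hm.2.2)

/-! ### The modular chain -/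

/-- A chain for the arrangement without the part `P` is extended by the centre. -/
theorem IsMaxModularChain.snoc {r : ℕ} {X : Fin (r + 1) → Submodule K (Fin n → K)}
    (hX : (graphicalArr K (deletePart G P)).IsMaxModularChain X)
    (hX₀ : ∀ H ∈ P, ¬ (graphicalArr K (deletePart G P)).center ≤ H)
    (hmod : (graphicalArr K G).IsModular (graphicalArr K (deletePart G P)).center)
    (hcov : (graphicalArr K G).center ⋖ (graphicalArr K (deletePart G P)).center) :
    (graphicalArr K G).IsMaxModularChain
      (Fin.snoc X (graphicalArr K G).center : Fin (r + 1 + 1) → Submodule K (Fin n → K)) where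
  zero := by
    rw [← Fin.castSucc_zero, Fin.snoc_castSucc, hX.zero]
  last := Fin.snoc_last _ _
  strictAnti := by
    rw [Fin.strictAnti_iff_succ_lt]
    intro i
    induction i using Fin.lastCases with
    | last => rw [Fin.succ_last, Fin.snoc_last, Fin.snoc_castSucc, hX.last]; exact hcov.lt
    | cast i =>
      rw [← Fin.castSucc_succ, Fin.snoc_castSucc, Fin.snoc_castSucc]
      exact hX.strictAnti Fin.castSucc_lt_succ
  modular i := by
    induction i using Fin.lastCases with
    | last => rw [Fin.snoc_last]; exact isModular_center _
    | cast i => rw [Fin.snoc_castSucc]; exact isModular_of_deletePart hX₀ hmod (hX.modular i)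
  maximal Y hY hcomp := by
    have hcomp' (i : Fin (r + 1)) : Y ≤ X i ∨ X i ≤ Y := by
      have := hcomp i.castSucc
      rwa [Fin.snoc_castSucc] at this
    have hlast := hcomp' (Fin.last r)
    rw [hX.last] at hlast
    by_cases hle : (graphicalArr K (deletePart G P)).center ≤ Y
    · obtain ⟨i, hi⟩ := hX.maximal Y (mem_lattice_deletePart hX₀ hle hY) hcomp'
      exact ⟨i.castSucc, by rw [Fin.snoc_castSucc, hi]⟩
    · refine ⟨Fin.last _, ?_⟩
      rw [Fin.snoc_last]
      rcases hcov.eq_or_eq (center_le hY) (hlast.resolve_right hle) with h | h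
      · exact h
      · exact absurd h.ge hle

/-- Induction on the rank, removing one part at a time from the top of the chain. -/
theorem IsNice.exists_isMaxModularChain (r : ℕ) : ∀ (G : SimpleGraph (Fin n))
    (π : Set (Set (Submodule K (Fin n → K)))), (graphicalArr K G).rank = r →
    (graphicalArr K G).IsNice π → ∃ X : Fin (r + 1) → Submodule K (Fin n → K),
      (graphicalArr K G).IsMaxModularChain X ∧ π = Set.range (fun i : Fin r =>
        (graphicalArr K G).localization (X i.succ) \
          (graphicalArr K G).localization (X i.castSucc)) := by
  induction r with
  | zero =>
    intro G π hr hπ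
    have htop : (graphicalArr K G).center = ⊤ := by
      refine Submodule.eq_top_of_finrank_eq ?_
      have := rk_add_finrank (graphicalArr K G).center
      rw [rank] at hr
      rw [Module.finrank_fin_fun]
      omega
    refine ⟨fun _ => ⊤, ⟨rfl, htop.symm, fun i j hij => by omega, fun i => ?_, fun Y hY _ => ?_⟩,
      ?_⟩
    · exact htop ▸ isModular_center (graphicalArr K G)
    · exact ⟨0, top_le_iff.1 (htop ▸ center_le hY)⟩
    · rw [Set.range_eq_empty, Set.eq_empty_iff_forall_notMem]
      intro P hP
      obtain ⟨H, hH⟩ := hπ.partition.nonempty P hP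
      have hHc := hπ.subset hP hH
      have h₁ := (graphicalArr K G).finrank_add_one H hHc
      have h₂ : H = ⊤ := top_le_iff.1 (htop ▸ sInf_le hHc)
      rw [h₂, finrank_top, Module.finrank_fin_fun] at h₁
      omega
  | succ r ih =>
    intro G π hr hπ
    have hne : π.Nonempty := by
      by_contra! h
      have hc : (graphicalArr K G).carrier = ∅ := by
        rw [← hπ.partition.union, h, Set.sUnion_empty]
      rw [rank, center, hc, sInf_empty, rk, finrank_top, Module.finrank_fin_fun] at hr
      omega
    obtain ⟨P, hP, hmax⟩ := hπ.exists_maximal_part hne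
    have hX₀ : ∀ H ∈ P, ¬ (graphicalArr K (HypArr.deletePart G P)).center ≤ H :=
      fun H hH => hπ.not_center_deletePart_le hP hmax hH
    obtain ⟨H, hH⟩ := hπ.partition.nonempty P hP
    have hHc := hπ.subset hP hH
    have hcenter : (graphicalArr K G).center =
        (graphicalArr K (HypArr.deletePart G P)).center ⊓ H := by
      have h := hπ.eq_inf_of_mem hP (Y := (graphicalArr K G).center) ⟨_, subset_rfl, rfl⟩ hH
        (sInf_le hHc)
      have hloc : (graphicalArr K G).localization (graphicalArr K G).center =
          (graphicalArr K G).carrier :=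
        Set.ext fun H' => ⟨fun h => h.1, fun h => ⟨h, sInf_le h⟩⟩
      rwa [hloc, ← carrier_deletePart] at h
    have hdim := finrank_inf_add_one hHc (hX₀ H hH)
    rw [← hcenter] at hdim
    have hcov : (graphicalArr K G).center ⋖
        (graphicalArr K (HypArr.deletePart G P)).center := by
      have hle : (graphicalArr K G).center ≤ (graphicalArr K (HypArr.deletePart G P)).center :=
        hcenter.trans_le inf_le_left
      refine ⟨lt_of_le_of_ne hle fun h => ?_, fun Z h₁ h₂ => ?_⟩
      · rw [h] at hdim
        omega
      · have := Submodule.finrank_lt_finrank_of_lt h₁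
        have := Submodule.finrank_lt_finrank_of_lt h₂
        omega
    have hr' : (graphicalArr K (HypArr.deletePart G P)).rank = r := by
      have := rk_add_finrank (graphicalArr K G).center
      have := rk_add_finrank (graphicalArr K (HypArr.deletePart G P)).center
      rw [rank] at hr ⊢
      omega
    obtain ⟨X, hX, hrange⟩ := ih _ _ hr' (hπ.deletePart hP hX₀)
    refine ⟨Fin.snoc X (graphicalArr K G).center,
      hX.snoc hX₀ (hπ.isModular_center_deletePart hP hX₀) hcov, ?_⟩
    have hXc (i : Fin (r + 1)) : (graphicalArr K (HypArr.deletePart G P)).localization (X i) =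
        (graphicalArr K G).localization (X i) :=
      localization_deletePart hX₀ (center_le (hX.modular i).1)
    have hlast : (graphicalArr K G).localization (graphicalArr K G).center \
        (graphicalArr K G).localization (X (Fin.last r)) = P := by
      rw [← hXc, hX.last]
      ext H'
      simp only [localization, carrier_deletePart, Set.mem_sdiff, Set.mem_ofPred_eq]
      constructor
      · rintro ⟨⟨h₁, -⟩, h₂⟩
        by_contra h₃
        exact h₂ ⟨⟨h₁, h₃⟩, sInf_le (carrier_deletePart (K := K) ▸ ⟨h₁, h₃⟩)⟩
      · intro h
        exact ⟨⟨hπ.subset hP h, sInf_le (hπ.subset hP h)⟩, fun h' => h'.1.2 h⟩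
    have hins : π = insert P (π \ {P}) := by
      rw [Set.insert_sdiff_singleton, Set.insert_eq_of_mem hP]
    rw [hins, hrange]
    ext Q
    simp only [Set.mem_insert_iff, Set.mem_range]
    rw [Fin.exists_fin_succ', or_comm]
    refine or_congr (exists_congr fun i => ?_) ?_
    · rw [← Fin.castSucc_succ, Fin.snoc_castSucc, Fin.snoc_castSucc, hXc, hXc]
    · rw [Fin.succ_last, Fin.snoc_last, Fin.snoc_castSucc, hlast, eq_comm]

end HypArr

theorem theorem1p2 {K : Type*} [Field K] {n : ℕ} (G : SimpleGraph (Fin n))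
    (A : HypArr K n) (hA : A = graphicalArr K G)
    (r : ℕ) (hr : A.rank = r)
    (π : Set (Set (Submodule K (Fin n → K)))) (hπ : A.IsNice π) :
    ∃ X : Fin (r + 1) → Submodule K (Fin n → K),
      A.IsMaxModularChain X ∧
      π = Set.range (fun i : Fin r =>
        A.localization (X i.succ) \ A.localization (X i.castSucc)) := by
  subst hA
  exact HypArr.IsNice.exists_isMaxModularChain r G π hr hπ
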